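/- **Setting.** There are $n=3f+1$ validators: a set $B$ of Byzantine ones, a set $R$ of rational ones and the set $H$ of correct ones, with $|B|\le f$ and $|B|+|R|\le 2f$. Time is discrete. Each validator has a stake of $D>0$ coins. Messages of correct validators arrive within $\Delta$, except for one asynchronous period of length at most $\Delta_{GST}$; a message sent before the end of this period that may not arrive within $\Delta$ before the period starts arrives within $\Delta$ after its end. Let $\Delta^*=2\Delta+\Delta_{GST}$. A block has a parent, a round and a list of transactions; a transaction spends a set of unit coins and carries a fee, and may be the request or the completion of a validator's stake withdrawal. Two blocks conflict if neither is an ancestor of the other. The leader of round $r$ is validator $r \bmod n$. **Underlying protocol $\Pi$.** A certificate $QC(b)$ consists of votes of at least $2f+1$ validators. Correct validators witness a certified block only after its ancestors, and only if no coin is spent twice on its chain; they broadcast every certificate that they first witness; none of them signs the certificates of two conflicting blocks; the first correct validator to accept a certificate accepts no signature of a validator whose withdrawal request it has already witnessed on chain; in finite time only finitely many blocks are witnessed. **CoBRA (stake-bounded finalization).** Validator $p$ finalizes $b$ at time $t$ if it has witnessed $QC(b)$, has not detected two conflicting certified blocks (equivocation), and either it witnessed $b$ at least $\Delta^*$ ago,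 or the blocks of the chain of $b$ that it witnessed less than $\Delta^*$ ago spend at most $D$ coins in total. A validator withdraws its stake if, for some correct $p$, the completion of its withdrawal is in a block witnessed at least $\Delta^*$ after an ancestor block holding the request, and that block becomes $\Delta^*$-old at $p$ without $p$ having detected equivocation. **Utility.** A validator forks if it has signed the certificates of two conflicting blocks, both witnessed by correct validators. The amount of double-spent coins is $\sum_c\max(m_c-1,0)$, where $m_c$ is the number of distinct blocks finalized by correct validators in which coin $c$ is spent. A forking validator gets an equal share of this amount among the forking rational validators, and loses $D$ unless it withdraws its stake; it gets nothing else, as the system halts. A validator that does not fork gets, in each leader window (rounds $mn,\dots,mn+n-1$; one slot per validator), a participation reward plus a bribe. In a window each validator chooses to whom it delivers its proposal, for which received proposals it votes, and for which slots it commits finality votes; following the protocol means doing all of this. A slot is certified if its proposal gets at least $2f+1$ votes, and rewarded if moreover it or a later certified slot of the window gets at least $2f+1$ finality votes. If at least $n-f$ slots are certified, validator $i$ gets $F P_i/P$, where $F$ is the sum of the fees of the rewarded slots, $P_i$ the number of proposals, votes and finality votes of $i$ for rewarded slots (a finality vote counting if $i$ proposed or voted for the block), and $P=n(2n+1)$ the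 number of possible participations; otherwise it gets $0$. A bribe is a whole number of coins, paid to a validator in $R$ for not following the protocol in the window; the adversary pays out of a finite endowment and the participation rewards of Byzantine validators, and never pays more than it has. **Rationality.** Rational validators do not play weakly dominated strategies. (i) If, at every window, not forking weakly dominates forking for $q\in R$, then $q$ does not fork. Here weak dominance compares any two executions satisfying the rules above on the network, on $\Pi$ and on finalization, in which the votes, window actions and bribe offers of all other validators agree and $q$ forks in the first but not in the second: the utility of $q$ in the first is never greater than in the second, and it is smaller for at least one such pair. (ii) In every window starting after the asynchronous period, no $q\in R$ plays an action that is weakly dominated by following the protocol in the game of that window (with its proposed fees and offered bribes, against arbitrary actions of the others). **Liveness rules.** After the asynchronous period and while no equivocation is detected by a correct validator: correct validators follow the protocol in each window; a correct leader extends a block whose certificate it has witnessed, and its proposed chain contains every transaction that it has witnessed, except those sharing a coin with another transaction of that chain; if the proposal of a correct leader gets at least $2f+1$ votes in its window slot, all correct validators witness its certificate by the end of its round. **Theorem.** In every such execution, the correct validators running the composition of CoBRA and $\Pi$ agree on a total order: * *Safety.* No two blocks finalized by correct validators at any times conflict; hence of the ordered lists of transactions on the chains of any two finalized blocks, one is a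 prefix of the other. * *Liveness.* Let $tx$ be a transaction with positive fee that is witnessed by all correct validators and none of whose coins is spent by another transaction on the chain of a block witnessed by a correct validator or of a proposal of a correct validator. Then $tx$ is contained in some block that every correct validator finalizes. If moreover every proposal of a correct validator carries a positive volume of fees, then for every round $r$ there is a round $r'\ge r$ whose leader is correct and whose proposed block is finalized by every correct validator, and, for each such $tx$, $r'$ can be chosen so that $tx$ is in this block or one of its ancestors. -/

import Mathlib

open scoped Classical

noncomputable section

namespace CoBRA

/-- Parameters of the system. There are `n = 3 f + 1` validators, of which those in `byz` are
Byzantine, those in `rat` are rational and all others are correct. `Δ` is the message delay in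
synchrony, `ΔGST` the maximal length of the asynchronous period, `D` the stake of a validator
(which is also the bound of the stake-bounded finalization rule), `τ` the length of a round. -/
structure System where
  f : ℕ
  Δ : ℕ
  ΔGST : ℕ
  D : ℕ
  τ : ℕ
  D_pos : 0 < D
  τ_pos : 0 < τ
  byz : Finset (Fin (3 * f + 1))
  rat : Finset (Fin (3 * f + 1))
  disj : Disjoint byz rat
  byz_card : byz.card ≤ f
  bad_card : byz.card + rat.card ≤ 2 * f

namespace System
variable (S : System)

abbrev Validator : Type := Fin (3 * S.f + 1)

/-- The set of correct validators. -/
def correct : Finset S.Validator := (S.byz ∪ S.rat)ᶜ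

/-- `Δ* = 2 Δ + Δ_GST`. -/
def Δstar : ℕ := 2 * S.Δ + S.ΔGST

/-- Round-robin leader election. -/
def leader (r : ℕ) : S.Validator := ⟨r % (3 * S.f + 1), Nat.mod_lt _ (Nat.succ_pos _)⟩

end System

/-! ### Transactions and blocks -/

/-- A transaction is a payment, a request of a validator to withdraw its stake, or the second
transaction which completes that withdrawal. -/
inductive TxKind (V : Type) where
  | payment
  | withdrawRequest (v : V)
  | withdrawClaim (v : V)

/-- A transaction spends a set of unit coins and carries a fee. -/
structure Tx (V : Type) where
  id : ℕ
  kind : TxKind V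
  spends : Finset ℕ
  fee : ℕ

inductive Block (V : Type) where
  | genesis : Block V
  | mk (parent : Block V) (round : ℕ) (txs : List (Tx V)) : Block V

namespace Block
variable {V : Type}

/-- The transactions in the block itself. -/
def txs : Block V → List (Tx V)
  | genesis => []
  | mk _ _ t => t

/-- The block and all its ancestors. -/
def chain : Block V → List (Block V)
  | genesis => [genesis]
  | mk p r t => mk p r t :: p.chain

/-- All transactions on the chain ending in the block, in order. -/
def ledger : Block V → List (Tx V)
  | genesis => []
  | mk p _ t => p.ledger ++ t

/-- Neither block is an ancestor of the other one. -/
def Conflict (b b' : Block V) : Prop := b ∉ b'.chain ∧ b' ∉ b.chain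

/-- The amount of coins spent in the block. -/
def value (b : Block V) : ℕ := (b.txs.map fun x => x.spends.card).sum

/-- The volume of the transaction fees in the block. -/
def fees (b : Block V) : ℕ := (b.txs.map fun x => x.fee).sum

/-- No coin is spent twice on the chain ending in the block. -/
def Valid (b : Block V) : Prop := b.ledger.Pairwise fun x y => Disjoint x.spends y.spends

end Block

/-! ### The game played in one leader window -/

/-- `s` weakly dominates `s'` for player `i` in the normal form game with utilities `u`. -/
def WeaklyDominates {I A : Type} (u : (I → A) → I → ℚ) (i : I) (s s' : A) : Prop :=
  (∀ a : I → A, u (Function.update a i s') i ≤ u (Function.update a i s) i) ∧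
  ∃ a : I → A, u (Function.update a i s') i < u (Function.update a i s) i

/-- The actions of a validator in a leader window (`n` consecutive rounds, in which each validator
is leader once; the slot of a round is identified with its leader): the validators to which it
delivers its own proposal (the empty set if it does not propose), the slots for whose proposals it
votes when it receives them, and the slots for whose blocks it commits a finality vote. -/
@[ext] structure Action (V : Type) where
  sendTo : Finset V
  votes : Finset V
  finality : Finset V

namespace System
variable (S : System)

/-- Following the protocol with respect to liveness: propose, vote, commit finality votes. -/
def honest : Action S.Validator := ⟨Finset.univ, Finset.univ, Finset.univ⟩

section Window
variable (a : S.Validator → Action S.Validator)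

/-- Validator `i` votes for the proposal of slot `j`. -/
def VotesFor (i j : S.Validator) : Prop := i ∈ (a j).sendTo ∧ j ∈ (a i).votes

/-- The proposal of slot `j` gathers a certificate. -/
def Certified (j : S.Validator) : Prop :=
  2 * S.f + 1 ≤ (Finset.univ.filter fun i => S.VotesFor a i j).card

/-- At least `n - f` leaders of the window get a certificate for their proposal. -/
def WindowSuccess : Prop :=
  2 * S.f + 1 ≤ (Finset.univ.filter fun j => S.Certified a j).card

/-- At least `2 f + 1` finality votes are committed for block `j` or a subsequent block. -/
def Confirmed (j : S.Validator) : Prop :=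
  ∃ j', j ≤ j' ∧ S.Certified a j' ∧
    2 * S.f + 1 ≤ (Finset.univ.filter fun i => j' ∈ (a i).finality).card

def Rewarded (j : S.Validator) : Prop := S.Certified a j ∧ S.Confirmed a j

/-- Number of participations of `i` (proposals, votes, finality votes) in rewarded blocks. A
finality vote counts if its author has proposed the block or voted for it. -/
def participation (i : S.Validator) : ℕ :=
  (if S.Rewarded a i then 1 else 0) +
  (Finset.univ.filter fun j => S.Rewarded a j ∧ S.VotesFor a i j).card +
  (Finset.univ.filter fun j =>
    S.Rewarded a j ∧ j ∈ (a i).finality ∧ (i = j ∨ S.VotesFor a i j)).card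

/-- The number of possible participations in a window: in each of the `n` slots, one proposal,
`n` votes and `n` finality votes. -/
def slots : ℕ := (3 * S.f + 1) * (2 * (3 * S.f + 1) + 1)

/-- The participation reward: each participation yields an equal part of the fees. -/
def reward (fee : S.Validator → ℕ) (i : S.Validator) : ℚ :=
  if S.WindowSuccess a then
    ((∑ j ∈ Finset.univ.filter (fun j => S.Rewarded a j), fee j : ℕ) : ℚ) *
      (S.participation a i : ℚ) / (S.slots : ℚ)
  else 0

/-- The bribe which `i` actually gets: it is paid for not following the protocol. -/
def bribePaid (bribe : S.Validator → ℕ) (i : S.Validator) : ℕ :=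
  if a i = S.honest then 0 else bribe i

end Window

/-- The utility in a leader window. -/
def windowUtility (fee bribe : S.Validator → ℕ) (a : S.Validator → Action S.Validator)
    (i : S.Validator) : ℚ :=
  S.reward a fee i + (S.bribePaid a bribe i : ℚ)

end System

/-! ### Executions -/

/-- The events of a run. Time is counted in `ℕ`; an event at time `⊤` never happens. -/
structure Execution (S : System) where
  /-- the asynchronous period is `[asyncStart, gst)` -/
  asyncStart : ℕ
  gst : ℕ
  /-- the validator has signed a vote for the block -/
  vote : S.Validator → Block S.Validator → Prop
  /-- the validators whose signatures form the certificate `QC(b)`, if there is one -/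
  signers : Block S.Validator → Finset S.Validator
  /-- the time at which the validator first witnesses the block with its certificate -/
  witness : S.Validator → Block S.Validator → ℕ∞
  /-- the time at which the validator first witnesses the transaction -/
  mempool : S.Validator → Tx S.Validator → ℕ∞
  /-- parent and transactions of the block which the leader of a round proposes (if it does) -/
  parent : ℕ → Block S.Validator
  content : ℕ → List (Tx S.Validator)
  /-- the actions in each leader window -/
  act : ℕ → S.Validator → Action S.Validator
  /-- the bribe (in whole coins) offered in each leader window -/
  bribe : ℕ → S.Validator → ℕ
  /-- the coins which the adversary has at the beginning -/
  endowment : ℕ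

namespace Execution
variable {S : System} (E : Execution S)

/-- The block proposed in round `r`. -/
def proposal (r : ℕ) : Block S.Validator := Block.mk (E.parent r) r (E.content r)

/-- The round of slot `j` in window `m`. -/
def roundOf (_E : Execution S) (m : ℕ) (j : S.Validator) : ℕ := m * (3 * S.f + 1) + j.val

/-- The transaction fees in the block of slot `j` of window `m`. -/
def fee (m : ℕ) (j : S.Validator) : ℕ := (E.proposal (E.roundOf m j)).fees

/-- Time by which a message sent by a correct validator at time `t` is delivered to all correct
validators. -/
def deliveredBy (t : ℕ∞) : ℕ∞ :=
  if t + S.Δ < E.asyncStart ∨ (E.gst : ℕ∞) ≤ t then t + S.Δ else (E.gst : ℕ∞) + S.Δ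

/-- Some correct validator witnesses a certificate for the block. -/
def Witnessed (b : Block S.Validator) : Prop := ∃ p ∈ S.correct, E.witness p b ≠ ⊤

/-- Validator `p` has witnessed two conflicting certified blocks by time `t`. Their signers are
then blacklisted and slashed, and `p` stops. -/
def Detected (p : S.Validator) (t : ℕ) : Prop :=
  ∃ b b', Block.Conflict b b' ∧ E.witness p b ≤ t ∧ E.witness p b' ≤ t

/-- No correct validator has detected equivocation by time `t`. -/
def Running (t : ℕ) : Prop := ∀ p ∈ S.correct, ¬ E.Detected p t

/-- Total value of the `Δ*`-recent blocks in the chain of `b`, in the view of `p` at time `t`. -/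
def suffixValue (p : S.Validator) (b : Block S.Validator) (t : ℕ) : ℕ :=
  ((b.chain.filter fun b' => decide ((t : ℕ∞) < E.witness p b' + S.Δstar)).map Block.value).sum

/-- The finalization rule: at time `t` validator `p` has witnessed `b` with its certificate, has
not detected equivocation, and either `b` is `Δ*`-old or the total value of the `Δ*`-recent
blocks up to `b` is at most the stake `D`. -/
def Finalizes (p : S.Validator) (b : Block S.Validator) (t : ℕ) : Prop :=
  E.witness p b ≤ t ∧ ¬ E.Detected p t ∧
    (E.witness p b + S.Δstar ≤ t ∨ E.suffixValue p b t ≤ S.D)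

/-- `q` has issued a withdrawal request that `p` has witnessed on chain before time `t`. -/
def Exiting (p q : S.Validator) (t : ℕ∞) : Prop :=
  ∃ b, (∃ x ∈ b.txs, x.kind = TxKind.withdrawRequest q) ∧ E.witness p b < t

/-- Executions consistent with the quorum-based protocol and with the confirmation layer on top
of it. Nothing here restricts the votes of Byzantine or rational validators. -/
structure Admissible : Prop where
  /-- the asynchronous period is bounded -/
  async_le : E.asyncStart ≤ E.gst
  gst_le : E.gst ≤ E.asyncStart + S.ΔGST
  genesis : ∀ p ∈ S.correct, E.witness p Block.genesis = 0
  parent_first : ∀ p ∈ S.correct, ∀ b r t, E.witness p b ≤ E.witness p (Block.mk b r t)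
  /-- finitely many events in finite time -/
  finite : ∀ p ∈ S.correct, ∀ t : ℕ, {b | E.witness p b ≤ t}.Finite
  /-- a certificate is a quorum of votes -/
  quorum : ∀ b, b ≠ Block.genesis → E.Witnessed b →
    2 * S.f + 1 ≤ (E.signers b).card ∧ ∀ q ∈ E.signers b, E.vote q b
  /-- the first correct validator to accept a certificate ignores signatures of validators whose
  withdrawal request it has already witnessed -/
  not_exiting : ∀ b, b ≠ Block.genesis → E.Witnessed b → ∃ p ∈ S.correct,
    (∀ p' ∈ S.correct, E.witness p b ≤ E.witness p' b) ∧
    ∀ q ∈ E.signers b, ¬ E.Exiting p q (E.witness p b)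
  valid : ∀ b, E.Witnessed b → b.Valid
  /-- correct validators do not equivocate -/
  no_equivocation : ∀ p ∈ S.correct, ∀ b b', Block.Conflict b b' → E.Witnessed b →
    E.Witnessed b' → ¬ (p ∈ E.signers b ∧ p ∈ E.signers b')
  /-- correct validators broadcast every certificate when they first witness it -/
  broadcast : ∀ p ∈ S.correct, ∀ q ∈ S.correct, ∀ b,
    E.witness q b ≤ E.deliveredBy (E.witness p b)

/-! #### The decision to fork -/

/-- `q` has signed the certificates of two conflicting blocks. -/
def Forks (q : S.Validator) : Prop :=
  ∃ b b', Block.Conflict b b' ∧ E.Witnessed b ∧ E.Witnessed b' ∧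
    q ∈ E.signers b ∧ q ∈ E.signers b'

/-- The rational validators taking part in a fork. -/
def coalition : Finset S.Validator := S.rat.filter fun q => E.Forks q

/-- The number of distinct blocks finalized by correct validators in which coin `c` is spent. -/
def timesSpent (c : ℕ) : ℕ :=
  {b : Block S.Validator | (∃ p ∈ S.correct, ∃ t, E.Finalizes p b t) ∧
    ∃ x ∈ b.txs, c ∈ x.spends}.ncard

/-- The amount of double-spent coins. -/
def doubleSpent : ℕ := ∑ᶠ c : ℕ, (E.timesSpent c - 1)

/-- `q` withdraws its stake: for some correct validator, the completing transaction is in a block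
witnessed at least `Δ*` after the request, and this block becomes `Δ*`-old without detection of
equivocation. -/
def Withdraws (q : S.Validator) : Prop :=
  ∃ p ∈ S.correct, ∃ b b' : Block S.Validator, ∃ t : ℕ,
    (∃ x ∈ b.txs, x.kind = TxKind.withdrawRequest q) ∧
    (∃ x ∈ b'.txs, x.kind = TxKind.withdrawClaim q) ∧
    b ∈ b'.chain ∧
    E.witness p b + S.Δstar ≤ E.witness p b' ∧
    E.witness p b' + S.Δstar ≤ t ∧ ¬ E.Detected p t

/-- Utility of validator `q` at window `m`. A forking validator gets an equal share of the
double-spent coins and loses its stake unless it withdraws it; bribes and rewards are worthless to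
it, since the system halts. Otherwise it gets its participation reward and its bribe. -/
def utility (m : ℕ) (q : S.Validator) : ℚ :=
  if E.Forks q then
    (E.doubleSpent : ℚ) / (E.coalition.card : ℚ) - (if E.Withdraws q then 0 else (S.D : ℚ))
  else S.windowUtility (E.fee m) (E.bribe m) (E.act m) q

/-- All validators but `q` have the same strategy in both executions. -/
def AgreeExcept (q : S.Validator) (E E' : Execution S) : Prop :=
  ∀ p, p ≠ q → E.vote p = E'.vote p ∧ ∀ m, E.act m p = E'.act m p ∧ E.bribe m p = E'.bribe m p

end Execution

/-- For validator `q`, not forking weakly dominates participating in a fork, at window `m`. -/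
def ForkingDominated (S : System) (m : ℕ) (q : S.Validator) : Prop :=
  (∀ E E' : Execution S, E.Admissible → E'.Admissible → Execution.AgreeExcept q E E' →
    E.Forks q → ¬ E'.Forks q → E.utility m q ≤ E'.utility m q) ∧
  ∃ E E' : Execution S, E.Admissible ∧ E'.Admissible ∧ Execution.AgreeExcept q E E' ∧
    E.Forks q ∧ ¬ E'.Forks q ∧ E.utility m q < E'.utility m q

namespace Execution
variable {S : System} (E : Execution S)

/-! #### Behaviour with respect to liveness -/

/-- The coins which the adversary has at the beginning of window `m`: it accumulates the
participation rewards of the Byzantine validators and pays the bribes. -/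
def budget : ℕ → ℚ
  | 0 => (E.endowment : ℚ)
  | m + 1 => budget m + ∑ i ∈ S.byz, S.reward (E.act m) (E.fee m) i
      - ∑ i ∈ S.rat, (S.bribePaid (E.act m) (E.bribe m) i : ℚ)

/-- The liveness rules after the asynchronous period, as long as no equivocation is detected.
Round `r` takes place from time `r τ` to time `(r + 1) τ`. -/
structure Live : Prop where
  /-- correct validators follow the protocol -/
  correct_act : ∀ m, E.gst ≤ m * (3 * S.f + 1) * S.τ → E.Running (m * (3 * S.f + 1) * S.τ) →
    ∀ i ∈ S.correct, E.act m i = S.honest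
  /-- a vote for the proposal of a slot is a vote for that block -/
  votes : ∀ m i j, S.VotesFor (E.act m) i j → E.vote i (E.proposal (E.roundOf m j))
  /-- a correct leader extends a block whose certificate it has witnessed -/
  extends_ledger : ∀ r, S.leader r ∈ S.correct → E.gst ≤ r * S.τ → E.Running (r * S.τ) →
    E.witness (S.leader r) (E.parent r) ≤ ((r * S.τ : ℕ) : ℕ∞)
  /-- a correct leader includes each transaction that it has witnessed, unless it is already in
  the ledger or shares a coin with another one -/
  includes : ∀ r, S.leader r ∈ S.correct → E.gst ≤ r * S.τ → E.Running (r * S.τ) →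
    ∀ x, E.mempool (S.leader r) x ≤ ((r * S.τ : ℕ) : ℕ∞) →
    (∀ y ∈ (E.proposal r).ledger, y ≠ x → Disjoint y.spends x.spends) →
    x ∈ (E.proposal r).ledger
  /-- progress of the quorum-based protocol: if a correct leader proposes a block and a quorum
  votes for it in its round, then every correct validator witnesses its certificate in that
  round -/
  progress : ∀ m j, j ∈ S.correct →
    E.gst ≤ E.roundOf m j * S.τ → E.Running (E.roundOf m j * S.τ) →
    S.Certified (E.act m) j →
    ∀ p ∈ S.correct,
      E.witness p (E.proposal (E.roundOf m j)) ≤ (((E.roundOf m j + 1) * S.τ : ℕ) : ℕ∞)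
  /-- the adversary cannot pay more than it has -/
  solvent : ∀ m, ∑ i ∈ S.rat, (S.bribePaid (E.act m) (E.bribe m) i : ℚ) ≤ E.budget m

/-- Rational validators do not play weakly dominated strategies: they do not fork if this is
weakly dominated, and in the leader windows they do not play actions that are weakly dominated by
following the protocol. -/
structure Rational : Prop where
  fork : ∀ q ∈ S.rat, (∀ m, ForkingDominated S m q) → ¬ E.Forks q
  window : ∀ m, E.gst ≤ m * (3 * S.f + 1) * S.τ → ∀ q ∈ S.rat,
    ¬ WeaklyDominates (S.windowUtility (E.fee m) (E.bribe m)) q S.honest (E.act m q)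

/-- Every correct validator finalizes the block. -/
def FinalizedByAll (b : Block S.Validator) : Prop :=
  ∀ p ∈ S.correct, ∃ t, E.Finalizes p b t

/-- A fee-paying transaction witnessed by all correct validators, none of whose coins is spent by
another transaction in a certified block or in a proposal of a correct validator. -/
def Pending (x : Tx S.Validator) : Prop :=
  0 < x.fee ∧ (∀ p ∈ S.correct, E.mempool p x ≠ ⊤) ∧
  (∀ b, E.Witnessed b → ∀ y ∈ b.ledger, y ≠ x → Disjoint y.spends x.spends) ∧
  ∀ r, S.leader r ∈ S.correct → ∀ y ∈ (E.proposal r).ledger, y ≠ x → Disjoint y.spends x.spends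

/-- Correct validators finalize no conflicting blocks, and so the ordered lists of transactions
that they finalize, at any times, are prefixes of one another. -/
def Safety : Prop :=
  ∀ p ∈ S.correct, ∀ q ∈ S.correct, ∀ b b' t t', E.Finalizes p b t → E.Finalizes q b' t' →
    ¬ Block.Conflict b b' ∧ (b.ledger <+: b'.ledger ∨ b'.ledger <+: b.ledger)

/-- Each pending transaction is eventually in a block finalized by all correct validators. If
moreover the proposals of correct validators always carry fees, then, from any round on, some
correct validator proposes a block that is finalized by all correct validators and has the
transaction in its chain. -/
def Liveness : Prop :=
  (∀ x, E.Pending x → ∃ b, x ∈ b.txs ∧ E.FinalizedByAll b) ∧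
  ((∀ r, S.leader r ∈ S.correct → 0 < (E.proposal r).fees) →
    ∀ r, (∃ r', r ≤ r' ∧ S.leader r' ∈ S.correct ∧ E.FinalizedByAll (E.proposal r')) ∧
      ∀ x, E.Pending x → ∃ r', r ≤ r' ∧ S.leader r' ∈ S.correct ∧
        x ∈ (E.proposal r').ledger ∧ E.FinalizedByAll (E.proposal r'))

end Execution

end CoBRA

end

/-!
The theorem has an economic and a combinatorial half, joined by the rationality assumptions.

*No rational validator forks.* Suppose correct validators witness conflicting blocks. Since
certificates propagate within `Δ*`, every correct validator eventually detects this, and the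
finalized blocks form finitely many branches, ending in pairwise conflicting tips. Take the tip
finalized last. Every `Δ*`-old block of another branch is then known to the validator finalizing
that tip, so it lies below the tip, and the other branch contributes only `Δ*`-recent blocks, which
spend at most `D` coins. Hence `k` branches double-spend at most `(k - 1) D` coins
(`Execution.doubleSpent_le`). Counting signatures under the `k` tips shows that at least `k - 1`
rational validators fork (`Execution.card_le_coalition_add_one`), so a forking validator gains at
most `D`. It cannot save its stake either: a certificate with its signature is accepted only before
its withdrawal request is known, hence is known everywhere when the withdrawal completes
(`Execution.Forks.not_withdraws`). So forking never yields a positive utility, whereas not forking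
never yields a negative one; and forking with two empty blocks costs exactly `D`. This is weak
dominance (`forkingDominated`), provided that `|B| + |R| ≥ f + 1`; with fewer such validators
no fork is possible at all.

*Safety.* Two conflicting certificates share `f + 1` signers, none of them correct, so one of them
is a forking rational validator. As there is none, witnessed blocks never conflict.

*Liveness.* Equivocation is never detected, so correct validators follow the protocol and every
witnessed block is finalized after `Δ*`. In a window with positive fees, following the protocol
weakly dominates every other action of a validator that is offered no bribe
(`System.weaklyDominates_honest`). If no slot of a correct validator is certified in such a window,
then some rational validator has deviated and was paid at least one coin, while fewer than `n - f`
slots are certified, so the Byzantine validators earn nothing: the budget of the adversary drops by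
at least `1` (`Execution.certified_or_budget`). As the budget stays nonnegative, a slot of a correct
validator is eventually certified. A pending transaction itself provides the fees, unless a correct
leader already extends a certified chain that contains it.
-/

noncomputable section

namespace CoBRA

namespace Block
variable {V : Type}

/-! ### Chains of blocks -/

lemma self_mem_chain (b : Block V) : b ∈ b.chain := by
  cases b <;> simp [chain]

lemma genesis_mem_chain (b : Block V) : genesis ∈ b.chain := by
  induction b with
  | genesis => simp [chain]
  | mk p r t ih => simp [chain, ih]

lemma mem_chain_trans {a b c : Block V} (hab : a ∈ b.chain) (hbc : b ∈ c.chain) :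
    a ∈ c.chain := by
  induction c with
  | genesis =>
    simp only [chain, List.mem_singleton] at hbc
    exact hbc ▸ hab
  | mk p r t ih =>
    rcases List.mem_cons.1 hbc with rfl | h
    · exact hab
    · exact List.mem_cons_of_mem _ (ih h)

lemma length_chain_le {a b : Block V} (h : a ∈ b.chain) : a.chain.length ≤ b.chain.length := by
  induction b with
  | genesis =>
    simp only [chain, List.mem_singleton] at h
    exact h ▸ le_rfl
  | mk p r t ih =>
    rcases List.mem_cons.1 h with rfl | h
    · exact le_rfl
    · exact (ih h).trans (by simp [chain])

lemma mk_notMem_chain (p : Block V) (r : ℕ) (t : List (Tx V)) : mk p r t ∉ p.chain := fun h => by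
  simpa [chain] using length_chain_le h

lemma nodup_chain (b : Block V) : b.chain.Nodup := by
  induction b with
  | genesis => simp [chain]
  | mk p r t ih => exact List.nodup_cons.2 ⟨mk_notMem_chain p r t, ih⟩

lemma mem_chain_total {a b c : Block V} (ha : a ∈ c.chain) (hb : b ∈ c.chain) :
    a ∈ b.chain ∨ b ∈ a.chain := by
  induction c with
  | genesis =>
    simp only [chain, List.mem_singleton] at ha hb
    subst ha hb
    exact Or.inl (self_mem_chain _)
  | mk p r t ih =>
    rcases List.mem_cons.1 ha with rfl | ha'
    · exact Or.inr hb
    rcases List.mem_cons.1 hb with rfl | hb'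
    · exact Or.inl ha
    · exact ih ha' hb'

lemma Conflict.symm {a b : Block V} (h : Conflict a b) : Conflict b a := ⟨h.2, h.1⟩

lemma Conflict.ne_genesis {a b : Block V} (h : Conflict a b) : a ≠ genesis := by
  rintro rfl
  exact h.1 (genesis_mem_chain b)

lemma ledger_prefix {a b : Block V} (h : a ∈ b.chain) : a.ledger <+: b.ledger := by
  induction b with
  | genesis =>
    simp only [chain, List.mem_singleton] at h
    exact h ▸ List.prefix_rfl
  | mk p r t ih =>
    rcases List.mem_cons.1 h with rfl | h
    · exact List.prefix_rfl
    · exact (ih h).trans (List.prefix_append _ _)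

lemma mem_ledger {x : Tx V} {b : Block V} : x ∈ b.ledger ↔ ∃ a ∈ b.chain, x ∈ a.txs := by
  induction b with
  | genesis => simp [chain, ledger, txs]
  | mk p r t ih => simp [chain, ledger, ih, txs, or_comm]

lemma not_conflict_ledger {a b : Block V} (h : ¬ Conflict a b) :
    a.ledger <+: b.ledger ∨ b.ledger <+: a.ledger := by
  unfold Conflict at h
  rw [not_and_or, not_not, not_not] at h
  exact h.imp ledger_prefix ledger_prefix

/-! ### Coins spent in a block -/

/-- The set of coins spent by the transactions of a block. -/
def coins (b : Block V) : Finset ℕ := b.txs.foldr (fun x s => x.spends ∪ s) ∅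

lemma mem_coins {b : Block V} {c : ℕ} : c ∈ b.coins ↔ ∃ x ∈ b.txs, c ∈ x.spends := by
  unfold coins
  induction b.txs with
  | nil => simp
  | cons x l ih => simp [ih]

lemma card_coins_le (b : Block V) : b.coins.card ≤ b.value := by
  unfold coins value
  induction b.txs with
  | nil => simp
  | cons x l ih =>
    simp only [List.foldr_cons, List.map_cons, List.sum_cons]
    exact (Finset.card_union_le _ _).trans (Nat.add_le_add_left ih _)

/-- A valid chain spends each coin in at most one of its blocks. -/
lemma Valid.eq_of_mem_coins {a b d : Block V} (hd : d.Valid) (ha : a ∈ d.chain)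
    (hb : b ∈ d.chain) {c : ℕ} (hca : c ∈ a.coins) (hcb : c ∈ b.coins) : a = b := by
  have key : ∀ {a b : Block V}, b ∈ d.chain → c ∈ a.coins → c ∈ b.coins → a ∈ b.chain →
      a = b := by
    intro a b hb hca hcb hab
    obtain ⟨x, hx, hcx⟩ := mem_coins.1 hca
    obtain ⟨y, hy, hcy⟩ := mem_coins.1 hcb
    cases b with
    | genesis => simpa [chain] using hab
    | mk p r t =>
      rcases List.mem_cons.1 hab with h | h
      · exact h
      have hv : (mk p r t).Valid := List.Pairwise.sublist (ledger_prefix hb).sublist hd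
      have hdisj := (List.pairwise_append.1 hv).2.2 x (mem_ledger.2 ⟨a, h, hx⟩) y hy
      exact absurd hcy (Finset.disjoint_left.1 hdisj hcx)
  rcases mem_chain_total ha hb with h | h
  · exact key hb hca hcb h
  · exact (key ha hcb hca h).symm

end Block

namespace Execution
variable {S : System} {E : Execution S}

/-! ### Message delay and detection of equivocation -/

lemma deliveredBy_le (hA : E.Admissible) (t : ℕ∞) : E.deliveredBy t ≤ t + S.Δstar := by
  have h1 := hA.async_le
  have h2 := hA.gst_le
  induction t using ENat.recTopCoe with
  | top => simp
  | coe t =>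
    unfold deliveredBy System.Δstar
    split_ifs with h
    · norm_cast; omega
    · norm_cast at h ⊢; omega

/-- A block that a correct validator has witnessed for `Δ*` is known to all correct validators. -/
lemma witness_le_add (hA : E.Admissible) {p q : S.Validator} (hp : p ∈ S.correct)
    (hq : q ∈ S.correct) (b : Block S.Validator) : E.witness q b ≤ E.witness p b + S.Δstar :=
  (hA.broadcast p hp q hq b).trans (deliveredBy_le hA _)

lemma witness_le_of_mem_chain (hA : E.Admissible) {p : S.Validator} (hp : p ∈ S.correct)
    {a b : Block S.Validator} (h : a ∈ b.chain) : E.witness p a ≤ E.witness p b := by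
  induction b with
  | genesis =>
    simp only [Block.chain, List.mem_singleton] at h
    exact h ▸ le_rfl
  | mk c r t ih =>
    rcases List.mem_cons.1 h with rfl | h
    · exact le_rfl
    · exact (ih h).trans (hA.parent_first p hp c r t)

lemma witness_ne_top (hA : E.Admissible) {b : Block S.Validator} (hb : E.Witnessed b)
    {p : S.Validator} (hp : p ∈ S.correct) : E.witness p b ≠ ⊤ := by
  obtain ⟨q, hq, h⟩ := hb
  exact ne_top_of_le_ne_top (by simpa using h) (witness_le_add hA hq hp b)

lemma Finalizes.witnessed {p : S.Validator} (hp : p ∈ S.correct) {b : Block S.Validator} {t : ℕ}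
    (h : E.Finalizes p b t) : E.Witnessed b :=
  ⟨p, hp, ne_top_of_le_ne_top (ENat.natCast_ne_top t) h.1⟩

lemma Detected.mono {p : S.Validator} {t t' : ℕ} (h : E.Detected p t) (htt : t ≤ t') :
    E.Detected p t' := by
  obtain ⟨b, b', hc, h1, h2⟩ := h
  have : (t : ℕ∞) ≤ t' := by exact_mod_cast htt
  exact ⟨b, b', hc, h1.trans this, h2.trans this⟩

lemma exists_detected (hA : E.Admissible) {b b' : Block S.Validator} (hc : Block.Conflict b b')
    (hb : E.Witnessed b) (hb' : E.Witnessed b') {p : S.Validator} (hp : p ∈ S.correct) :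
    ∃ t, E.Detected p t := by
  obtain ⟨s, hs⟩ := ENat.ne_top_iff_exists.1 (witness_ne_top hA hb hp)
  obtain ⟨s', hs'⟩ := ENat.ne_top_iff_exists.1 (witness_ne_top hA hb' hp)
  refine ⟨max s s', b, b', hc, ?_, ?_⟩
  · rw [← hs]; exact_mod_cast le_max_left _ _
  · rw [← hs']; exact_mod_cast le_max_right _ _

/-- Once equivocation is witnessed, correct validators stop, so they finalize only finitely many
blocks. -/
lemma finite_finalized (hA : E.Admissible) {b b' : Block S.Validator} (hc : Block.Conflict b b')
    (hb : E.Witnessed b) (hb' : E.Witnessed b') :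
    {b : Block S.Validator | ∃ p ∈ S.correct, ∃ t, E.Finalizes p b t}.Finite := by
  have h : ∀ p ∈ S.correct, {b | ∃ t, E.Finalizes p b t}.Finite := by
    intro p hp
    obtain ⟨T, hT⟩ := exists_detected hA hc hb hb' hp
    refine (hA.finite p hp T).subset ?_
    rintro d ⟨t, ht⟩
    have htT : t ≤ T := by
      by_contra hlt
      exact ht.2.1 (hT.mono (by omega))
    exact ht.1.trans (by exact_mod_cast htT)
  refine (Set.Finite.biUnion S.correct.finite_toSet h).subset ?_
  rintro d ⟨p, hp, hd⟩
  exact Set.mem_biUnion (Finset.mem_coe.2 hp) hd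

/-- Whichever clause of the finalization rule applies, the `Δ*`-recent blocks of a finalized
chain spend at most the stake. -/
lemma Finalizes.suffixValue_le (hA : E.Admissible) {p : S.Validator} (hp : p ∈ S.correct)
    {b : Block S.Validator} {t : ℕ} (h : E.Finalizes p b t) : E.suffixValue p b t ≤ S.D := by
  rcases h.2.2 with h1 | h1
  · have : (b.chain.filter fun b' => decide ((t : ℕ∞) < E.witness p b' + S.Δstar)) = [] := by
      refine List.filter_eq_nil_iff.2 fun a ha => ?_
      simpa using (add_le_add_left (witness_le_of_mem_chain hA hp ha) _).trans h1
    simp [suffixValue, this]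
  · exact h1

/-! ### Signers of conflicting certificates -/

/-- A validator outside `B` and outside the forking coalition signs at most one of several
pairwise conflicting certificates. -/
lemma card_signed_le_one (hA : E.Admissible) {A : Finset (Block S.Validator)}
    (hW : ∀ b ∈ A, E.Witnessed b)
    (hC : ∀ b ∈ A, ∀ b' ∈ A, b ≠ b' → Block.Conflict b b') {v : S.Validator}
    (hv : v ∉ S.byz ∪ E.coalition) : (A.filter fun b => v ∈ E.signers b).card ≤ 1 := by
  rw [Finset.card_le_one]
  intro b hb b' hb'
  rw [Finset.mem_filter] at hb hb'
  by_contra hne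
  have hc := hC b hb.1 b' hb'.1 hne
  have hcor : v ∉ S.correct := fun h =>
    hA.no_equivocation v h b b' hc (hW b hb.1) (hW b' hb'.1) ⟨hb.2, hb'.2⟩
  rw [Finset.mem_union, not_or] at hv
  have hr : v ∈ S.rat := by
    simp only [System.correct, Finset.mem_compl, Finset.mem_union, not_not] at hcor
    exact hcor.resolve_left hv.1
  exact hv.2 (Finset.mem_filter.2
    ⟨hr, b, b', hc, hW b hb.1, hW b' hb'.1, hb.2, hb'.2⟩)

lemma coalition_subset : E.coalition ⊆ S.rat := Finset.filter_subset _ _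

lemma card_byz_union_coalition :
    (S.byz ∪ E.coalition).card = S.byz.card + E.coalition.card :=
  Finset.card_union_of_disjoint (S.disj.mono_right coalition_subset)

/-- Double counting of the signatures under pairwise conflicting certificates: `k ≥ 2` branches
need at least `k - 1` forking rational validators. -/
lemma card_le_coalition_add_one (hA : E.Admissible) {A : Finset (Block S.Validator)}
    (hW : ∀ b ∈ A, E.Witnessed b)
    (hC : ∀ b ∈ A, ∀ b' ∈ A, b ≠ b' → Block.Conflict b b') :
    A.card ≤ E.coalition.card + 1 := by
  rcases Nat.lt_or_ge A.card 2 with hk | hk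
  · omega
  have hlow : A.card * (2 * S.f + 1) ≤ ∑ b ∈ A, (E.signers b).card := by
    rw [← smul_eq_mul]
    refine Finset.card_nsmul_le_sum _ _ _ fun b hb => ?_
    obtain ⟨b', hb', hne⟩ := Finset.exists_mem_ne (by omega : 1 < A.card) b
    exact (hA.quorum b (hC b hb b' hb' hne.symm).ne_genesis (hW b hb)).1
  have hswap : ∑ b ∈ A, (E.signers b).card
      = ∑ v : S.Validator, (A.filter fun b => v ∈ E.signers b).card := by
    simp only [Finset.card_filter]
    rw [Finset.sum_comm]
    refine Finset.sum_congr rfl fun b _ => ?_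
    simp
  have hup : ∑ v : S.Validator, (A.filter fun b => v ∈ E.signers b).card
      ≤ A.card * (S.byz ∪ E.coalition).card + (S.byz ∪ E.coalition)ᶜ.card := by
    rw [← Finset.sum_add_sum_compl (S.byz ∪ E.coalition)]
    refine Nat.add_le_add ?_ ?_
    · refine (Finset.sum_le_card_nsmul _ _ A.card fun v _ => Finset.card_filter_le _ _).trans ?_
      exact (mul_comm _ _).le
    · refine (Finset.sum_le_card_nsmul _ _ 1 fun v hv =>
        card_signed_le_one hA hW hC (Finset.mem_compl.1 hv)).trans ?_
      exact (mul_one _).le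
  have hcompl : (S.byz ∪ E.coalition)ᶜ.card = 3 * S.f + 1 - (S.byz ∪ E.coalition).card := by
    rw [Finset.card_compl, Fintype.card_fin]
  have hX : E.coalition.card ≤ S.rat.card := Finset.card_le_card coalition_subset
  rw [hcompl, card_byz_union_coalition] at hup
  have hb1 := S.byz_card
  have hb2 := S.bad_card
  -- With `k = j + 2` branches and `2 f - |B| - |X| = d`, the count says `(j + 1) (d + 1) ≤ f`.
  obtain ⟨j, hj⟩ : ∃ j, A.card = j + 2 := ⟨A.card - 2, by omega⟩
  obtain ⟨d, hd⟩ : ∃ d, 2 * S.f + 1 = S.byz.card + E.coalition.card + (d + 1) :=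
    ⟨2 * S.f - S.byz.card - E.coalition.card, by omega⟩
  obtain ⟨e, he⟩ : ∃ e, e = 3 * S.f + 1 - (S.byz.card + E.coalition.card) := ⟨_, rfl⟩
  have he' : e = S.f + (d + 1) := by omega
  have hmain := (hlow.trans_eq hswap).trans hup
  rw [← he, he', hd, hj] at hmain
  have : j * d + j + d + 1 ≤ S.f := by nlinarith
  have := Nat.zero_le (j * d)
  omega

/-- Two conflicting certificates share `f + 1` signers, none of them correct. -/
lemma exists_forks_of_conflict (hA : E.Admissible) {b b' : Block S.Validator}
    (hc : Block.Conflict b b') (hb : E.Witnessed b) (hb' : E.Witnessed b') :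
    S.f + 1 ≤ S.byz.card + S.rat.card ∧ ∃ q ∈ S.rat, E.Forks q := by
  have h1 := (hA.quorum b hc.ne_genesis hb).1
  have h2 := (hA.quorum b' hc.symm.ne_genesis hb').1
  have h3 := Finset.card_union_add_card_inter (E.signers b) (E.signers b')
  have h4 : (E.signers b ∪ E.signers b').card ≤ 3 * S.f + 1 := by
    simpa using Finset.card_le_univ (E.signers b ∪ E.signers b')
  have hsub : E.signers b ∩ E.signers b' ⊆ S.byz ∪ E.coalition := by
    intro v hv
    rw [Finset.mem_inter] at hv
    by_contra hn
    have hcor : v ∉ S.correct := fun h => hA.no_equivocation v h b b' hc hb hb' hv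
    rw [Finset.mem_union, not_or] at hn
    simp only [System.correct, Finset.mem_compl, Finset.mem_union, not_not] at hcor
    exact hn.2 (Finset.mem_filter.2
      ⟨hcor.resolve_left hn.1, b, b', hc, hb, hb', hv.1, hv.2⟩)
  have h5 := Finset.card_le_card hsub
  rw [card_byz_union_coalition] at h5
  have hX : E.coalition.card ≤ S.rat.card := Finset.card_le_card coalition_subset
  have hB := S.byz_card
  refine ⟨by omega, ?_⟩
  obtain ⟨q, hq⟩ := Finset.card_pos.1 (by omega : 0 < E.coalition.card)
  exact ⟨q, Finset.mem_filter.1 hq⟩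

/-! ### The cost of forking -/

/-- A forking validator does not get its stake back: its forking signatures were accepted before
its withdrawal request was known everywhere, hence are known everywhere when the withdrawal
completes. -/
lemma Forks.not_withdraws (hA : E.Admissible) {q : S.Validator} (hq : E.Forks q) :
    ¬ E.Withdraws q := by
  rintro ⟨p, hp, b, b', t, hreq, -, -, h1, h2, hdet⟩
  obtain ⟨c, c', hc, hw, hw', hs, hs'⟩ := hq
  have key : ∀ d, d ≠ Block.genesis → E.Witnessed d → q ∈ E.signers d → E.witness p d ≤ t := by
    intro d hd hwd hsd
    obtain ⟨p₁, hp₁, -, hex⟩ := hA.not_exiting d hd hwd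
    have hle : E.witness p₁ d ≤ E.witness p₁ b := by
      by_contra hlt
      exact hex q hsd ⟨b, hreq, not_le.1 hlt⟩
    calc E.witness p d ≤ E.witness p₁ d + S.Δstar := witness_le_add hA hp₁ hp d
      _ ≤ E.witness p b' + S.Δstar :=
        add_le_add_left ((hle.trans (witness_le_add hA hp hp₁ b)).trans h1) _
      _ ≤ t := h2
  exact hdet ⟨c, c', hc, key c hc.ne_genesis hw hs, key c' hc.symm.ne_genesis hw' hs'⟩

/-- The gain from a fork is at most `D` per forking rational validator. All finalized branches
but the one finalized last share with the latter everything that is not `Δ*`-recent, so each of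
them double-spends at most `D`. -/
lemma doubleSpent_le (hA : E.Admissible)
    (hfin : {b : Block S.Validator | ∃ p ∈ S.correct, ∃ t, E.Finalizes p b t}.Finite) :
    E.doubleSpent ≤ E.coalition.card * S.D := by
  set F : Finset (Block S.Validator) := hfin.toFinset with hF
  have memF : ∀ b, b ∈ F ↔ ∃ p ∈ S.correct, ∃ t, E.Finalizes p b t := fun b => by simp [hF]
  have htimes : ∀ c, E.timesSpent c = (F.filter fun b => c ∈ b.coins).card := by
    intro c
    rw [timesSpent, ← Set.ncard_coe_finset]
    congr 1
    ext b
    simp [memF, Block.mem_coins]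
  -- `A` consists of the tips of the finalized branches.
  set A : Finset (Block S.Validator) :=
    F.filter fun b => ∀ b' ∈ F, b ∈ b'.chain → b' = b with hAdef
  have hAF : ∀ b ∈ A, b ∈ F := fun b hb => (Finset.mem_filter.1 hb).1
  have hAmax : ∀ b ∈ A, ∀ b' ∈ F, b ∈ b'.chain → b' = b := fun b hb => (Finset.mem_filter.1 hb).2
  have hcover : ∀ b ∈ F, ∃ M ∈ A, b ∈ M.chain := by
    intro b hb
    obtain ⟨M, hM, hmax⟩ := Finset.exists_max_image (F.filter fun b' => b ∈ b'.chain)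
      (fun b' => b'.chain.length) ⟨b, Finset.mem_filter.2 ⟨hb, b.self_mem_chain⟩⟩
    rw [Finset.mem_filter] at hM
    refine ⟨M, Finset.mem_filter.2 ⟨hM.1, fun b' hb' hMb' => ?_⟩, hM.2⟩
    have hlen := hmax b' (Finset.mem_filter.2 ⟨hb', Block.mem_chain_trans hM.2 hMb'⟩)
    cases b' with
    | genesis => simpa [Block.chain, eq_comm] using hMb'
    | mk c r t =>
      rcases List.mem_cons.1 hMb' with h | h
      · exact h.symm
      · have := Block.length_chain_le h
        simp only [Block.chain, List.length_cons] at hlen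
        omega
  rcases A.eq_empty_or_nonempty with hAe | hAne
  · have hFe : F = ∅ := by
      refine Finset.eq_empty_of_forall_notMem fun b hb => ?_
      obtain ⟨M, hM, -⟩ := hcover b hb
      simp [hAe] at hM
    simp [doubleSpent, htimes, hFe]
  have hex : ∀ M, ∃ p t, M ∈ A → p ∈ S.correct ∧ E.Finalizes p M t := by
    intro M
    by_cases h : M ∈ A
    · obtain ⟨p, hp, t, ht⟩ := (memF M).1 (hAF M h)
      exact ⟨p, t, fun _ => ⟨hp, ht⟩⟩
    · exact ⟨0, 0, fun h' => absurd h' h⟩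
  choose p t hpt using hex
  obtain ⟨M₀, hM₀, hlast⟩ := Finset.exists_max_image A t hAne
  have hcard : (A.erase M₀).card ≤ E.coalition.card := by
    have := card_le_coalition_add_one hA
      (fun b hb => (hpt b hb).2.witnessed (hpt b hb).1)
      (A := A) fun b hb b' hb' hne =>
        ⟨fun h => hne (hAmax b hb b' (hAF b' hb') h).symm,
          fun h => hne (hAmax b' hb' b (hAF b hb) h)⟩
    rw [Finset.card_erase_of_mem hM₀]
    omega
  choose! g hgA hgchain using hcover
  set N : Finset (Block S.Validator) := F.filter fun b => b ∉ M₀.chain with hN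
  have hvalid₀ : M₀.Valid := hA.valid _ ((hpt M₀ hM₀).2.witnessed (hpt M₀ hM₀).1)
  -- The valid chain of `M₀` contains at most one of the blocks spending `c`.
  have hcoin : ∀ c, E.timesSpent c - 1 ≤ (N.filter fun b => c ∈ b.coins).card := by
    intro c
    have hsplit := Finset.card_filter_add_card_filter_not
      (s := F.filter fun b => c ∈ b.coins) (fun b => b ∈ M₀.chain)
    have hone : ((F.filter fun b => c ∈ b.coins).filter fun b => b ∈ M₀.chain).card ≤ 1 := by
      rw [Finset.card_le_one]
      intro a ha b hb
      simp only [Finset.mem_filter] at ha hb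
      exact hvalid₀.eq_of_mem_coins ha.2 hb.2 ha.1.2 hb.1.2
    rw [hN, Finset.filter_comm, htimes]
    omega
  have hsum : E.doubleSpent ≤ ∑ b ∈ N, b.value := by
    have hsupp : (Function.support fun c => E.timesSpent c - 1) ⊆
        (N.biUnion Block.coins : Finset ℕ) := by
      intro c hc
      have hc' : 0 < E.timesSpent c - 1 := Nat.pos_of_ne_zero hc
      obtain ⟨b, hb⟩ := Finset.card_pos.1 (hc'.trans_le (hcoin c))
      rw [Finset.mem_filter] at hb
      exact Finset.mem_coe.2 (Finset.mem_biUnion.2 ⟨b, hb.1, hb.2⟩)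
    rw [doubleSpent, finsum_eq_sum_of_support_subset _ hsupp]
    calc ∑ c ∈ N.biUnion Block.coins, (E.timesSpent c - 1)
        ≤ ∑ c ∈ N.biUnion Block.coins, (N.filter fun b => c ∈ b.coins).card :=
          Finset.sum_le_sum fun c _ => hcoin c
      _ = ∑ b ∈ N, ((N.biUnion Block.coins).filter fun c => c ∈ b.coins).card := by
          simp only [Finset.card_filter]
          exact Finset.sum_comm
      _ ≤ ∑ b ∈ N, b.value := by
          refine Finset.sum_le_sum fun b _ => (Finset.card_le_card ?_).trans b.card_coins_le
          exact fun c hc => (Finset.mem_filter.1 hc).2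
  have hmaps : ∀ b ∈ N, g b ∈ A.erase M₀ := by
    intro b hb
    rw [hN, Finset.mem_filter] at hb
    refine Finset.mem_erase.2 ⟨fun h => hb.2 (h ▸ hgchain b hb.1), hgA b hb.1⟩
  have hbranch : ∀ M ∈ A.erase M₀, ∑ b ∈ N.filter (fun b => g b = M), b.value ≤ S.D := by
    intro M hM
    obtain ⟨hne, hMA⟩ := Finset.mem_erase.1 hM
    obtain ⟨hp, hfz⟩ := hpt M hMA
    obtain ⟨hp₀, hfz₀⟩ := hpt M₀ hM₀
    refine le_trans ?_ (hfz.suffixValue_le hA hp)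
    rw [suffixValue, ← List.sum_toFinset _ (M.nodup_chain.filter _)]
    refine Finset.sum_le_sum_of_subset fun b hb => ?_
    obtain ⟨hbN, rfl⟩ := Finset.mem_filter.1 hb
    obtain ⟨hbF, hb₀⟩ := Finset.mem_filter.1 hbN
    have hbM := hgchain b hbF
    simp only [List.mem_toFinset, List.mem_filter, decide_eq_true_eq]
    refine ⟨hbM, ?_⟩
    -- A `Δ*`-old block is known to the validator that finalizes `M₀` later.
    by_contra hold
    have hwit : E.witness (p M₀) b ≤ t M₀ :=
      ((witness_le_add hA hp hp₀ b).trans (not_lt.1 hold)).trans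
        (by exact_mod_cast hlast _ hMA)
    refine hfz₀.2.1 ⟨b, M₀, ⟨hb₀, fun h => hne ?_⟩, hwit, hfz₀.1⟩
    exact hAmax M₀ hM₀ _ (hAF _ hMA) (Block.mem_chain_trans h hbM)
  calc E.doubleSpent ≤ ∑ b ∈ N, b.value := hsum
    _ = ∑ M ∈ A.erase M₀, ∑ b ∈ N.filter (fun b => g b = M), b.value :=
        (Finset.sum_fiberwise_of_maps_to hmaps _).symm
    _ ≤ (A.erase M₀).card * S.D := by
        rw [← smul_eq_mul]
        exact Finset.sum_le_card_nsmul _ _ _ hbranch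
    _ ≤ E.coalition.card * S.D := Nat.mul_le_mul_right _ hcard

end Execution

namespace System
variable {S : System}

lemma card_correct : S.correct.card + (S.byz.card + S.rat.card) = 3 * S.f + 1 := by
  have h := Finset.card_compl_add_card (S.byz ∪ S.rat)
  rw [Finset.card_union_of_disjoint S.disj, Fintype.card_fin] at h
  exact h

lemma correct_nonempty : S.correct.Nonempty := by
  have h1 := S.card_correct
  have h2 := S.bad_card
  exact Finset.card_pos.1 (by omega)

lemma reward_nonneg (a : S.Validator → Action S.Validator) (fee : S.Validator → ℕ)
    (i : S.Validator) : 0 ≤ S.reward a fee i := by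
  unfold reward
  split_ifs <;> positivity

lemma windowUtility_nonneg (fee bribe : S.Validator → ℕ) (a : S.Validator → Action S.Validator)
    (i : S.Validator) : 0 ≤ S.windowUtility fee bribe a i :=
  add_nonneg (S.reward_nonneg a fee i) (Nat.cast_nonneg _)

end System

namespace Execution
variable {S : System} {E : Execution S}

lemma Forks.utility_nonpos (hA : E.Admissible) {q : S.Validator} (hr : q ∈ S.rat)
    (hq : E.Forks q) (m : ℕ) : E.utility m q ≤ 0 := by
  rw [utility, if_pos hq, if_neg (hq.not_withdraws hA), sub_nonpos]
  have hpos : 0 < E.coalition.card := Finset.card_pos.2 ⟨q, Finset.mem_filter.2 ⟨hr, hq⟩⟩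
  obtain ⟨b, b', hc, hb, hb', -⟩ := hq
  have h := doubleSpent_le hA (finite_finalized hA hc hb hb')
  rw [div_le_iff₀ (by exact_mod_cast hpos), mul_comm]
  exact_mod_cast h

/-! ### An execution in which forking costs the stake -/

/-- The synchronous execution in which everybody votes for every block, and the correct validators
witness the blocks of `W`, with certificates `sig`, at time `0` and no other blocks. -/
def instant (S : System) (W : Finset (Block S.Validator))
    (sig : Block S.Validator → Finset S.Validator) : Execution S where
  asyncStart := 0
  gst := 0
  vote _ _ := True
  signers := sig
  witness _ b := if b ∈ W then 0 else ⊤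
  mempool _ _ := ⊤
  parent _ := Block.genesis
  content _ := []
  act _ _ := S.honest
  bribe _ _ := 0
  endowment := 0

variable {W : Finset (Block S.Validator)} {sig : Block S.Validator → Finset S.Validator}

lemma instant_witness (p : S.Validator) (b : Block S.Validator) :
    (instant S W sig).witness p b = if b ∈ W then 0 else ⊤ := rfl

lemma mem_of_instant_le {p : S.Validator} {b : Block S.Validator} {t : ℕ}
    (h : (instant S W sig).witness p b ≤ t) : b ∈ W := by
  by_contra hb
  rw [instant_witness, if_neg hb, top_le_iff] at h
  exact ENat.natCast_ne_top t h

lemma instant_witnessed {b : Block S.Validator} : (instant S W sig).Witnessed b ↔ b ∈ W := by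
  constructor
  · rintro ⟨p, -, h⟩
    by_contra hb
    exact h (if_neg hb)
  · intro hb
    obtain ⟨p, hp⟩ := S.correct_nonempty
    exact ⟨p, hp, by simp [instant_witness, hb]⟩

lemma instant_admissible (hgen : Block.genesis ∈ W)
    (hpar : ∀ b r t, Block.mk b r t ∈ W → b ∈ W) (hempty : ∀ b ∈ W, b.ledger = [])
    (hquorum : ∀ b ∈ W, b ≠ Block.genesis → 2 * S.f + 1 ≤ (sig b).card)
    (hcorrect : ∀ p ∈ S.correct, ∀ b ∈ W, ∀ b' ∈ W, Block.Conflict b b' →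
      ¬ (p ∈ sig b ∧ p ∈ sig b')) :
    (instant S W sig).Admissible where
  async_le := le_rfl
  gst_le := Nat.zero_le _
  genesis p _ := if_pos hgen
  parent_first p _ b r t := by
    by_cases h : Block.mk b r t ∈ W
    · simp [instant_witness, hpar b r t h]
    · simp [instant_witness, h]
  finite p _ t := W.finite_toSet.subset fun b hb => mem_of_instant_le hb
  quorum b hb hw := ⟨hquorum b (instant_witnessed.1 hw) hb, fun _ _ => trivial⟩
  not_exiting b _ hw := by
    obtain ⟨p, hp⟩ := S.correct_nonempty
    refine ⟨p, hp, fun _ _ => le_rfl, ?_⟩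
    rintro q - ⟨d, ⟨x, hx, -⟩, hd⟩
    have hdW : d ∈ W := by
      by_contra h
      rw [instant_witness, if_neg h] at hd
      exact not_top_lt hd
    have : x ∈ d.ledger := Block.mem_ledger.2 ⟨d, d.self_mem_chain, hx⟩
    simp [hempty d hdW] at this
  valid b hb := by
    rw [Block.Valid, hempty b (instant_witnessed.1 hb)]
    exact List.Pairwise.nil
  no_equivocation p hp b b' hc hb hb' :=
    hcorrect p hp b (instant_witnessed.1 hb) b' (instant_witnessed.1 hb') hc
  broadcast p _ q _ b := by
    by_cases h : b ∈ W
    · simp [instant_witness, h]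
    · simp [instant_witness, h, deliveredBy]

/-- Among empty blocks there is nothing to double-spend and no stake is withdrawn. -/
lemma instant_utility (hempty : ∀ b ∈ W, b.ledger = []) {q : S.Validator}
    (hq : (instant S W sig).Forks q) (m : ℕ) : (instant S W sig).utility m q = -S.D := by
  have hno : ∀ b ∈ W, ∀ x ∈ b.txs, False := by
    intro b hb x hx
    have : x ∈ b.ledger := Block.mem_ledger.2 ⟨b, b.self_mem_chain, hx⟩
    simp [hempty b hb] at this
  have hts : ∀ c, (instant S W sig).timesSpent c = 0 := by
    intro c
    rw [timesSpent]
    convert Set.ncard_empty (Block S.Validator)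
    refine Set.eq_empty_of_forall_notMem ?_
    rintro b ⟨⟨p, -, t, hf⟩, x, hx, -⟩
    exact hno b (mem_of_instant_le hf.1) x hx
  have hds : (instant S W sig).doubleSpent = 0 := by simp [doubleSpent, hts]
  have hwd : ¬ (instant S W sig).Withdraws q := by
    rintro ⟨p, -, b, b', t, -, ⟨x, hx, -⟩, -, -, h, -⟩
    exact hno b' (mem_of_instant_le (le_self_add.trans h)) x hx
  rw [utility, if_pos hq, if_neg hwd, hds]
  simp

end Execution

open Execution in
/-- Not forking weakly dominates forking as soon as the Byzantine and rational validators are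
numerous enough to fork at all. -/
lemma forkingDominated {S : System} (hbad : S.f + 1 ≤ S.byz.card + S.rat.card) {q : S.Validator}
    (hq : q ∈ S.rat) (m : ℕ) : ForkingDominated S m q := by
  refine ⟨fun E E' hE _ _ hf hf' => ?_, ?_⟩
  · refine (hf.utility_nonpos hE hq m).trans ?_
    rw [utility, if_neg hf']
    exact S.windowUtility_nonneg _ _ _ _
  -- Two empty blocks on top of genesis: the correct validators are split into `C` and the rest,
  -- and each part completes a quorum together with all the other validators.
  have hcc := S.card_correct
  have hB := S.bad_card
  obtain ⟨C, hC, hCcard⟩ := Finset.exists_subset_card_eq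
    (s := S.correct) (n := 2 * S.f + 1 - (S.byz.card + S.rat.card)) (by omega)
  let b₁ : Block S.Validator := Block.mk Block.genesis 0 []
  let b₂ : Block S.Validator := Block.mk Block.genesis 1 []
  let sig : Block S.Validator → Finset S.Validator := fun b =>
    if b = b₁ then S.byz ∪ S.rat ∪ C else Cᶜ
  let W : Finset (Block S.Validator) := {Block.genesis, b₁, b₂}
  have hne : b₂ ≠ b₁ := by simp [b₁, b₂]
  have hconf : Block.Conflict b₁ b₂ := by simp [Block.Conflict, Block.chain, b₁, b₂]
  have hsig₁ : sig b₁ = S.byz ∪ S.rat ∪ C := if_pos rfl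
  have hsig₂ : sig b₂ = Cᶜ := if_neg hne
  have hdisj : Disjoint (S.byz ∪ S.rat) C :=
    (disjoint_compl_right (a := S.byz ∪ S.rat)).mono_right hC
  have hc₁ : 2 * S.f + 1 ≤ (sig b₁).card := by
    rw [hsig₁, Finset.card_union_of_disjoint hdisj, Finset.card_union_of_disjoint S.disj]
    omega
  have hc₂ : 2 * S.f + 1 ≤ (sig b₂).card := by
    rw [hsig₂, Finset.card_compl, Fintype.card_fin]
    omega
  have hsep : ∀ p ∈ S.correct, ¬ (p ∈ sig b₁ ∧ p ∈ sig b₂) := by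
    intro p hp
    rw [hsig₁, hsig₂, Finset.mem_union, Finset.mem_compl]
    rintro ⟨h | h, h'⟩
    · exact Finset.mem_compl.1 hp h
    · exact h' h
  have hempty : ∀ b ∈ W, b.ledger = [] := by simp [W, b₁, b₂, Block.ledger]
  have hforked : (instant S W sig).Admissible := by
    refine instant_admissible (by simp [W])
      (by simp only [W, b₁, b₂, Finset.mem_insert, Finset.mem_singleton]; aesop) hempty ?_ ?_
    · intro b hb hb0
      simp only [W, Finset.mem_insert, Finset.mem_singleton] at hb
      rcases hb with rfl | rfl | rfl
      · exact absurd rfl hb0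
      · exact hc₁
      · exact hc₂
    · intro p hp b hb b' hb' hc
      have hg := hc.ne_genesis
      have hg' := hc.symm.ne_genesis
      have hself : b ≠ b' := fun h => hc.1 (h ▸ b.self_mem_chain)
      simp only [W, Finset.mem_insert, Finset.mem_singleton] at hb hb'
      rcases hb with rfl | rfl | rfl
      · exact absurd rfl hg
      · rcases hb' with rfl | rfl | rfl
        · exact absurd rfl hg'
        · exact absurd rfl hself
        · exact hsep p hp
      · rcases hb' with rfl | rfl | rfl
        · exact absurd rfl hg'
        · exact fun h => hsep p hp h.symm
        · exact absurd rfl hself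
  have hforks : (instant S W sig).Forks q := by
    refine ⟨b₁, b₂, hconf, instant_witnessed.2 (by simp [W]), instant_witnessed.2 (by simp [W]),
      ?_, ?_⟩
    · change q ∈ sig b₁
      simp [hsig₁, hq]
    · change q ∈ sig b₂
      rw [hsig₂, Finset.mem_compl]
      exact fun h => Finset.disjoint_left.1 hdisj (Finset.mem_union_right _ hq) h
  have hquiet : ¬ (instant S {Block.genesis} sig).Forks q := by
    rintro ⟨b, b', hc, hb, -⟩
    exact hc.ne_genesis (by simpa using instant_witnessed.1 hb)
  refine ⟨instant S W sig, instant S {Block.genesis} sig, hforked, ?_, ?_, hforks, hquiet, ?_⟩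
  · refine instant_admissible (by simp) (by simp) (by simp [Block.ledger]) ?_ ?_
    · intro b hb hb0
      exact absurd (by simpa using hb) hb0
    · intro p _ b hb b' _ hc
      exact absurd (by simpa using hb) hc.ne_genesis
  · exact fun p _ => ⟨rfl, fun _ => ⟨rfl, rfl⟩⟩
  · rw [instant_utility hempty hforks]
    have hD : (0 : ℚ) < S.D := by exact_mod_cast S.D_pos
    rw [utility, if_neg hquiet]
    exact (neg_neg_of_pos hD).trans_le (S.windowUtility_nonneg _ _ _ _)

namespace Execution
variable {S : System} {E : Execution S}

/-! ### Safety -/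

lemma not_conflict_of_witnessed (hA : E.Admissible) (hR : E.Rational) {b b' : Block S.Validator}
    (hb : E.Witnessed b) (hb' : E.Witnessed b') : ¬ Block.Conflict b b' := by
  intro hc
  obtain ⟨hbad, q, hq, hf⟩ := exists_forks_of_conflict hA hc hb hb'
  exact hR.fork q hq (forkingDominated hbad hq) hf

lemma not_detected (hA : E.Admissible) (hR : E.Rational) {p : S.Validator} (hp : p ∈ S.correct)
    (t : ℕ) : ¬ E.Detected p t := by
  rintro ⟨b, b', hc, h, h'⟩
  exact not_conflict_of_witnessed hA hR ⟨p, hp, ne_top_of_le_ne_top (ENat.natCast_ne_top t) h⟩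
    ⟨p, hp, ne_top_of_le_ne_top (ENat.natCast_ne_top t) h'⟩ hc

lemma safety (hA : E.Admissible) (hR : E.Rational) : E.Safety := by
  intro p hp q hq b b' t t' h h'
  have hn := not_conflict_of_witnessed hA hR (h.witnessed hp) (h'.witnessed hq)
  exact ⟨hn, Block.not_conflict_ledger hn⟩

/-- Without equivocation, every witnessed block becomes `Δ*`-old and is finalized. -/
lemma finalizedByAll (hA : E.Admissible) (hR : E.Rational) {b : Block S.Validator}
    (hb : E.Witnessed b) : E.FinalizedByAll b := by
  intro p hp
  obtain ⟨s, hs⟩ := ENat.ne_top_iff_exists.1 (witness_ne_top hA hb hp)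
  refine ⟨s + S.Δstar, ?_, not_detected hA hR hp _, Or.inl ?_⟩
  · rw [← hs]; exact_mod_cast Nat.le_add_right _ _
  · rw [← hs]; exact le_of_eq (by push_cast; rfl)

end Execution

/-! ### The window game -/

/-- The definition of `WeaklyDominates`, with an arbitrary instance of decidable equality. -/
lemma weaklyDominates_iff {I A : Type} [DecidableEq I] {u : (I → A) → I → ℚ} {i : I} {s s' : A} :
    WeaklyDominates u i s s' ↔
      (∀ a : I → A, u (Function.update a i s') i ≤ u (Function.update a i s) i) ∧
      ∃ a : I → A, u (Function.update a i s') i < u (Function.update a i s) i := by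
  unfold WeaklyDominates
  convert Iff.rfl

namespace System
variable {S : System}

section Monotone
variable {a a' : S.Validator → Action S.Validator}

lemma VotesFor.mono (hs : ∀ i, (a i).sendTo ⊆ (a' i).sendTo) (hv : ∀ i, (a i).votes ⊆ (a' i).votes)
    {i j : S.Validator} (h : S.VotesFor a i j) : S.VotesFor a' i j :=
  ⟨hs j h.1, hv i h.2⟩

lemma Certified.mono (hs : ∀ i, (a i).sendTo ⊆ (a' i).sendTo)
    (hv : ∀ i, (a i).votes ⊆ (a' i).votes) {j : S.Validator} (h : S.Certified a j) :
    S.Certified a' j :=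
  h.trans (Finset.card_le_card (Finset.monotone_filter_right _ fun _ _ => VotesFor.mono hs hv))

lemma WindowSuccess.mono (hs : ∀ i, (a i).sendTo ⊆ (a' i).sendTo)
    (hv : ∀ i, (a i).votes ⊆ (a' i).votes) (h : S.WindowSuccess a) : S.WindowSuccess a' :=
  h.trans (Finset.card_le_card (Finset.monotone_filter_right _ fun _ _ => Certified.mono hs hv))

lemma Rewarded.mono (hs : ∀ i, (a i).sendTo ⊆ (a' i).sendTo)
    (hv : ∀ i, (a i).votes ⊆ (a' i).votes) (hf : ∀ i, (a i).finality ⊆ (a' i).finality)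
    {j : S.Validator} (h : S.Rewarded a j) : S.Rewarded a' j := by
  obtain ⟨h1, j', hj, h2, h3⟩ := h
  exact ⟨h1.mono hs hv, j', hj, h2.mono hs hv,
    h3.trans (Finset.card_le_card (Finset.monotone_filter_right _ fun i _ h => hf i h))⟩

/-- Doing more of the protocol never lowers a participation count, and it raises the count if it
adds a rewarded own proposal, a vote or a finality vote. -/
lemma participation_mono (hs : ∀ i, (a i).sendTo ⊆ (a' i).sendTo)
    (hv : ∀ i, (a i).votes ⊆ (a' i).votes) (hf : ∀ i, (a i).finality ⊆ (a' i).finality)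
    (i : S.Validator) :
    S.participation a i ≤ S.participation a' i ∧
    ((S.Rewarded a' i ∧ ¬ S.Rewarded a i) ∨
      (∃ j, S.Rewarded a' j ∧ S.VotesFor a' i j ∧ j ∉ (a i).votes) ∨
      (∃ j, S.Rewarded a' j ∧ j ∈ (a' i).finality ∧ S.VotesFor a' i j ∧ j ∉ (a i).finality) →
      S.participation a i < S.participation a' i) := by
  have h1 : (if S.Rewarded a i then 1 else 0) ≤ if S.Rewarded a' i then 1 else 0 := by
    by_cases h : S.Rewarded a i
    · simp [h, h.mono hs hv hf]
    · simp [h]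
  have hsub2 : (Finset.univ.filter fun j => S.Rewarded a j ∧ S.VotesFor a i j) ⊆
      Finset.univ.filter fun j => S.Rewarded a' j ∧ S.VotesFor a' i j :=
    Finset.monotone_filter_right _ fun j _ h => ⟨h.1.mono hs hv hf, h.2.mono hs hv⟩
  have hsub3 : (Finset.univ.filter fun j =>
        S.Rewarded a j ∧ j ∈ (a i).finality ∧ (i = j ∨ S.VotesFor a i j)) ⊆
      Finset.univ.filter fun j =>
        S.Rewarded a' j ∧ j ∈ (a' i).finality ∧ (i = j ∨ S.VotesFor a' i j) :=
    Finset.monotone_filter_right _ fun j _ h =>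
      ⟨h.1.mono hs hv hf, hf i h.2.1, h.2.2.imp_right (VotesFor.mono hs hv)⟩
  have h2 := Finset.card_le_card hsub2
  have h3 := Finset.card_le_card hsub3
  refine ⟨Nat.add_le_add (Nat.add_le_add h1 h2) h3, ?_⟩
  rintro (⟨h, hn⟩ | ⟨j, hr, hvf, hn⟩ | ⟨j, hr, hjf, hvf, hn⟩)
  · refine Nat.add_lt_add_of_lt_of_le (Nat.add_lt_add_of_lt_of_le ?_ h2) h3
    simp [h, hn]
  · refine Nat.add_lt_add_of_lt_of_le (Nat.add_lt_add_of_le_of_lt h1 ?_) h3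
    refine Finset.card_lt_card (Finset.ssubset_iff_of_subset hsub2 |>.2 ⟨j, ?_, ?_⟩)
    · simp [hr, hvf]
    · exact fun h => hn (Finset.mem_filter.1 h).2.2.2
  · refine Nat.add_lt_add_of_le_of_lt (Nat.add_le_add h1 h2) ?_
    refine Finset.card_lt_card (Finset.ssubset_iff_of_subset hsub3 |>.2 ⟨j, ?_, ?_⟩)
    · simp [hr, hvf, hjf]
    · simp [hn]

lemma rewardedFees_mono (hs : ∀ i, (a i).sendTo ⊆ (a' i).sendTo)
    (hv : ∀ i, (a i).votes ⊆ (a' i).votes) (hf : ∀ i, (a i).finality ⊆ (a' i).finality)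
    (fee : S.Validator → ℕ) :
    ∑ j ∈ Finset.univ.filter (fun j => S.Rewarded a j), fee j ≤
      ∑ j ∈ Finset.univ.filter (fun j => S.Rewarded a' j), fee j :=
  Finset.sum_le_sum_of_subset
    (Finset.monotone_filter_right _ fun _ _ => Rewarded.mono hs hv hf)

lemma slots_pos : (0 : ℚ) < S.slots := by
  have : 0 < S.slots := Nat.mul_pos (Nat.succ_pos _) (Nat.succ_pos _)
  exact_mod_cast this

lemma reward_mono (hs : ∀ i, (a i).sendTo ⊆ (a' i).sendTo)
    (hv : ∀ i, (a i).votes ⊆ (a' i).votes) (hf : ∀ i, (a i).finality ⊆ (a' i).finality)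
    (fee : S.Validator → ℕ) (i : S.Validator) : S.reward a fee i ≤ S.reward a' fee i := by
  by_cases h : S.WindowSuccess a
  · rw [reward, if_pos h, reward, if_pos (h.mono hs hv)]
    have hF := rewardedFees_mono hs hv hf fee
    have hP := (participation_mono hs hv hf i).1
    exact div_le_div_of_nonneg_right (by exact_mod_cast Nat.mul_le_mul hF hP) slots_pos.le
  · rw [reward, if_neg h]
    exact S.reward_nonneg a' fee i

lemma reward_lt (hs : ∀ i, (a i).sendTo ⊆ (a' i).sendTo)
    (hv : ∀ i, (a i).votes ⊆ (a' i).votes) (hf : ∀ i, (a i).finality ⊆ (a' i).finality)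
    {fee : S.Validator → ℕ} {i : S.Validator} (hw : S.WindowSuccess a')
    (hfee : 0 < ∑ j ∈ Finset.univ.filter (fun j => S.Rewarded a' j), fee j)
    (hP : S.participation a i < S.participation a' i) : S.reward a fee i < S.reward a' fee i := by
  have ha' : S.reward a' fee i = _ := if_pos hw
  rw [ha']
  by_cases h : S.WindowSuccess a
  · rw [reward, if_pos h]
    have hF := rewardedFees_mono hs hv hf fee
    refine div_lt_div_of_pos_right ?_ slots_pos
    exact_mod_cast (Nat.mul_le_mul_right _ hF).trans_lt (Nat.mul_lt_mul_of_pos_left hP hfee)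
  · rw [reward, if_neg h]
    refine div_pos ?_ slots_pos
    exact_mod_cast Nat.mul_pos hfee ((Nat.zero_le _).trans_lt hP)

end Monotone

section Update
variable (a : S.Validator → Action S.Validator) (q : S.Validator) (s : Action S.Validator)

lemma update_sendTo_subset (i : S.Validator) :
    (Function.update a q s i).sendTo ⊆ (Function.update a q S.honest i).sendTo := by
  rcases eq_or_ne i q with rfl | h
  · simp [honest]
  · simp [h]

lemma update_votes_subset (i : S.Validator) :
    (Function.update a q s i).votes ⊆ (Function.update a q S.honest i).votes := by
  rcases eq_or_ne i q with rfl | h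
  · simp [honest]
  · simp [h]

lemma update_finality_subset (i : S.Validator) :
    (Function.update a q s i).finality ⊆ (Function.update a q S.honest i).finality := by
  rcases eq_or_ne i q with rfl | h
  · simp [honest]
  · simp [h]

end Update

/-- If every slot is certified and everybody commits all finality votes, every slot is
rewarded: the last slot confirms all the others. -/
lemma rewarded_of_certified {a : S.Validator → Action S.Validator} (hc : ∀ j, S.Certified a j)
    (hf : ∀ i, (a i).finality = Finset.univ) (j : S.Validator) : S.Rewarded a j := by
  refine ⟨hc j, Fin.last _, Fin.le_last j, hc _, ?_⟩
  simp only [hf, Finset.mem_univ, Finset.filter_true, Finset.card_univ, Fintype.card_fin]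
  omega

lemma windowSuccess_of_certified {a : S.Validator → Action S.Validator}
    (hc : ∀ j, S.Certified a j) : S.WindowSuccess a := by
  simp only [WindowSuccess, hc, Finset.filter_true, Finset.card_univ, Fintype.card_fin]
  omega

/-- The profile in which everybody follows the protocol, except that only the members of `V` vote
for the proposal of slot `q`. -/
def quorumProfile (q : S.Validator) (V : Finset S.Validator) :
    S.Validator → Action S.Validator :=
  fun i => ⟨Finset.univ, Finset.univ.filter fun j => j = q → i ∈ V, Finset.univ⟩

lemma update_quorumProfile_honest {q : S.Validator} {V : Finset S.Validator} (hq : q ∈ V) :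
    Function.update (quorumProfile q V) q S.honest = quorumProfile q V := by
  rw [Function.update_eq_self_iff]
  simp [quorumProfile, honest, hq]

lemma votesFor_quorumProfile {q : S.Validator} {V : Finset S.Validator} {i j : S.Validator} :
    S.VotesFor (quorumProfile q V) i j ↔ (j = q → i ∈ V) := by
  simp [VotesFor, quorumProfile]

lemma certified_quorumProfile {q : S.Validator} {V : Finset S.Validator}
    (hV : 2 * S.f + 1 ≤ V.card) (j : S.Validator) : S.Certified (quorumProfile q V) j := by
  refine hV.trans (Finset.card_le_card fun i hi => ?_)
  simp [votesFor_quorumProfile, hi]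

/-- Following the protocol weakly dominates any other action of a validator that is offered no
bribe. A missing vote or finality vote costs a participation when all others follow the protocol;
withholding the proposal from `i` costs the slot when the vote of `i` is needed for its
certificate. -/
lemma weaklyDominates_honest (hf : 0 < S.f) {fee bribe : S.Validator → ℕ} {q : S.Validator}
    (hb : bribe q = 0) {k : S.Validator} (hk : 0 < fee k) {s : Action S.Validator}
    (hs : s ≠ S.honest) : WeaklyDominates (S.windowUtility fee bribe) q S.honest s := by
  have hutil : ∀ a, S.windowUtility fee bribe a q = S.reward a fee q := by
    intro a
    simp [windowUtility, bribePaid, hb]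
  simp only [weaklyDominates_iff, hutil]
  refine ⟨fun a => reward_mono (update_sendTo_subset a q s) (update_votes_subset a q s)
    (update_finality_subset a q s) fee q, ?_⟩
  -- In `quorumProfile q V` all slots are rewarded and fees are paid, so it suffices to lose a
  -- participation against it.
  have main : ∀ V : Finset S.Validator, 2 * S.f + 1 ≤ V.card → q ∈ V →
      (¬ S.Rewarded (Function.update (quorumProfile q V) q s) q ∨ (∃ j, j ∉ s.votes) ∨
        ∃ j, j ∉ s.finality) →
      ∃ a : S.Validator → Action S.Validator,
        S.reward (Function.update a q s) fee q < S.reward (Function.update a q S.honest) fee q := by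
    intro V hV hq hlose
    have hcert := certified_quorumProfile (q := q) hV
    have hrew := rewarded_of_certified hcert fun _ => rfl
    have h1 := update_sendTo_subset (quorumProfile q V) q s
    have h2 := update_votes_subset (quorumProfile q V) q s
    have h3 := update_finality_subset (quorumProfile q V) q s
    refine ⟨quorumProfile q V, ?_⟩
    rw [update_quorumProfile_honest hq] at h1 h2 h3 ⊢
    refine reward_lt h1 h2 h3 (windowSuccess_of_certified hcert) ?_
      ((participation_mono h1 h2 h3 q).2 ?_)
    · exact Finset.sum_pos' (fun _ _ => Nat.zero_le _) ⟨k, by simp [hrew], hk⟩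
    · refine hlose.imp (fun h => ⟨hrew q, h⟩) (Or.imp ?_ ?_)
      · rintro ⟨j, hj⟩
        exact ⟨j, hrew j, votesFor_quorumProfile.2 fun _ => hq, by simpa using hj⟩
      · rintro ⟨j, hj⟩
        exact ⟨j, hrew j, by simp [quorumProfile], votesFor_quorumProfile.2 fun _ => hq,
          by simpa using hj⟩
  by_cases hv : ∃ j, j ∉ s.votes
  · exact main Finset.univ (by rw [Finset.card_univ, Fintype.card_fin]; omega)
      (Finset.mem_univ q) (Or.inr (Or.inl hv))
  by_cases hfin : ∃ j, j ∉ s.finality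
  · exact main Finset.univ (by rw [Finset.card_univ, Fintype.card_fin]; omega)
      (Finset.mem_univ q) (Or.inr (Or.inr hfin))
  obtain ⟨i, hi⟩ : ∃ i, i ∉ s.sendTo := by
    by_contra hsend
    push Not at hv hfin hsend
    exact hs (Action.ext (Finset.eq_univ_of_forall hsend) (Finset.eq_univ_of_forall hv)
      (Finset.eq_univ_of_forall hfin))
  -- A quorum of exactly `2 f + 1` validators that needs the vote of `i`.
  have hqi : ({q, i} : Finset S.Validator).card ≤ 2 * S.f + 1 :=
    Finset.card_le_two.trans (by omega)
  obtain ⟨V, hsub, hcard⟩ := Finset.exists_superset_card_eq hqi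
    (by rw [Fintype.card_fin]; omega)
  refine main V hcard.ge (hsub (by simp)) (Or.inl fun hr => ?_)
  have hlt : (Finset.univ.filter fun v =>
      S.VotesFor (Function.update (quorumProfile q V) q s) v q).card < V.card := by
    refine Finset.card_lt_card (Finset.ssubset_iff_of_subset ?_ |>.2 ⟨i, hsub (by simp), ?_⟩)
    · intro v hv
      rcases eq_or_ne v q with rfl | hne
      · exact hsub (by simp)
      · have h := ((Finset.mem_filter.1 hv).2).2
        rw [Function.update_of_ne hne] at h
        exact (Finset.mem_filter.1 h).2 rfl
    · intro hv
      have h := ((Finset.mem_filter.1 hv).2).1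
      rw [Function.update_self] at h
      exact hi h
  have hcert := hr.1
  unfold Certified at hcert
  omega

/-- If the correct and the rational validators follow the protocol, their slots are certified. -/
lemma certified_of_honest {a : S.Validator → Action S.Validator}
    (h : ∀ i, i ∉ S.byz → a i = S.honest) {j : S.Validator} (hj : j ∉ S.byz) :
    S.Certified a j := by
  have hcard : 2 * S.f + 1 ≤ (S.byzᶜ).card := by
    rw [Finset.card_compl, Fintype.card_fin]
    have := S.byz_card
    omega
  refine hcard.trans (Finset.card_le_card fun i hi => ?_)
  simp [VotesFor, h j hj, h i (Finset.mem_compl.1 hi), honest]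

/-- A successful window has a certified slot of a correct validator. -/
lemma WindowSuccess.exists_correct {a : S.Validator → Action S.Validator}
    (h : S.WindowSuccess a) : ∃ j ∈ S.correct, S.Certified a j := by
  by_contra hn
  push Not at hn
  have hsub : (Finset.univ.filter fun j => S.Certified a j) ⊆ S.byz ∪ S.rat := by
    intro j hj
    by_contra hc
    exact hn j (Finset.mem_compl.2 hc) (Finset.mem_filter.1 hj).2
  have h1 := Finset.card_le_card hsub
  rw [Finset.card_union_of_disjoint S.disj] at h1
  have h2 := S.bad_card
  unfold WindowSuccess at h
  omega

end System

namespace Execution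
variable {S : System} {E : Execution S}

/-! ### Liveness -/

lemma leader_roundOf (m : ℕ) (j : S.Validator) : S.leader (E.roundOf m j) = j := by
  apply Fin.ext
  simp only [System.leader, roundOf]
  rw [mul_comm, Nat.mul_add_mod, Nat.mod_eq_of_lt j.isLt]

lemma le_roundOf (m : ℕ) (j : S.Validator) : m ≤ E.roundOf m j :=
  (Nat.le_mul_of_pos_right m (Nat.succ_pos _)).trans (Nat.le_add_right _ _)

lemma windowStart_le (m : ℕ) (j : S.Validator) :
    m * (3 * S.f + 1) * S.τ ≤ E.roundOf m j * S.τ :=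
  Nat.mul_le_mul_right _ (Nat.le_add_right _ _)

lemma le_windowStart (m : ℕ) : m ≤ m * (3 * S.f + 1) * S.τ :=
  (Nat.le_mul_of_pos_right m (Nat.succ_pos _)).trans (Nat.le_mul_of_pos_right _ S.τ_pos)

lemma running (hA : E.Admissible) (hR : E.Rational) (t : ℕ) : E.Running t :=
  fun _ hp => not_detected hA hR hp t

/-- A window with fees at stake either has a certified slot of a correct validator, or costs the
adversary at least one coin and yields it nothing. -/
lemma certified_or_budget (hA : E.Admissible) (hL : E.Live) (hR : E.Rational) {m : ℕ}
    (hm : E.gst ≤ m * (3 * S.f + 1) * S.τ) (hfee : ∃ k, 0 < E.fee m k) :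
    (∃ j ∈ S.correct, S.Certified (E.act m) j) ∨ E.budget (m + 1) ≤ E.budget m - 1 := by
  by_cases hc : ∃ j ∈ S.correct, S.Certified (E.act m) j
  · exact Or.inl hc
  right
  have hreward : ∀ i, S.reward (E.act m) (E.fee m) i = 0 := fun i =>
    if_neg fun hw => hc hw.exists_correct
  have hcor := hL.correct_act m hm (running hA hR _)
  obtain ⟨q, hq, hdev⟩ : ∃ q ∈ S.rat, E.act m q ≠ S.honest := by
    by_contra hall
    push Not at hall
    obtain ⟨j, hj⟩ := S.correct_nonempty
    have hnb : ∀ i ∈ S.correct, i ∉ S.byz := fun i hi hb =>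
      Finset.mem_compl.1 hi (Finset.mem_union_left _ hb)
    refine hc ⟨j, hj, System.certified_of_honest (fun i hi => ?_) (hnb j hj)⟩
    by_cases hir : i ∈ S.rat
    · exact hall i hir
    · exact hcor i (by simp [System.correct, hi, hir])
  have hf : 0 < S.f := by
    have h1 := S.bad_card
    have h2 : 0 < S.rat.card := Finset.card_pos.2 ⟨q, hq⟩
    omega
  have hbr : E.bribe m q ≠ 0 := fun h0 => by
    obtain ⟨k, hk⟩ := hfee
    exact hR.window m hm q hq (System.weaklyDominates_honest hf h0 hk hdev)
  have hpay : (1 : ℚ) ≤ ∑ i ∈ S.rat, (S.bribePaid (E.act m) (E.bribe m) i : ℚ) := by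
    refine le_trans ?_ (Finset.single_le_sum
      (f := fun i => (S.bribePaid (E.act m) (E.bribe m) i : ℚ))
      (fun i _ => Nat.cast_nonneg _) hq)
    rw [System.bribePaid, if_neg hdev]
    exact_mod_cast Nat.one_le_iff_ne_zero.2 hbr
  rw [budget]
  simp only [hreward, Finset.sum_const_zero]
  linarith

lemma budget_nonneg (hL : E.Live) (m : ℕ) : 0 ≤ E.budget m :=
  (Finset.sum_nonneg fun _ _ => Nat.cast_nonneg _).trans (hL.solvent m)

/-- The adversary runs out of coins: unless windows without fees intervene, some correct slot is
eventually certified. -/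
lemma exists_certified (hA : E.Admissible) (hL : E.Live) (hR : E.Rational) {m₀ : ℕ}
    (hm₀ : E.gst ≤ m₀ * (3 * S.f + 1) * S.τ) (hfee : ∀ m, m₀ ≤ m → ∃ k, 0 < E.fee m k) :
    ∃ m, m₀ ≤ m ∧ ∃ j ∈ S.correct, S.Certified (E.act m) j := by
  by_contra hn
  have hbud : ∀ k : ℕ, E.budget (m₀ + k) ≤ E.budget m₀ - k := by
    intro k
    induction k with
    | zero => simp
    | succ k ih =>
      have hle : m₀ ≤ m₀ + k := Nat.le_add_right _ _
      have hgst : E.gst ≤ (m₀ + k) * (3 * S.f + 1) * S.τ :=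
        hm₀.trans (Nat.mul_le_mul_right _ (Nat.mul_le_mul_right _ hle))
      rcases certified_or_budget hA hL hR hgst (hfee _ hle) with h | h
      · exact absurd ⟨_, hle, h⟩ hn
      · rw [← add_assoc]
        push_cast
        linarith
  obtain ⟨k, hk⟩ := exists_nat_gt (E.budget m₀)
  have h1 := hbud k
  have h2 := budget_nonneg hL (m₀ + k)
  linarith

lemma finalizedByAll_proposal (hA : E.Admissible) (hL : E.Live) (hR : E.Rational) {m : ℕ}
    (hm : E.gst ≤ m * (3 * S.f + 1) * S.τ) {j : S.Validator} (hj : j ∈ S.correct)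
    (hc : S.Certified (E.act m) j) : E.FinalizedByAll (E.proposal (E.roundOf m j)) := by
  have hw := hL.progress m j hj (hm.trans (windowStart_le m j)) (running hA hR _) hc j hj
  exact finalizedByAll hA hR ⟨j, hj, ne_top_of_le_ne_top (ENat.natCast_ne_top _) hw⟩

/-- From some time on, the proposals of correct leaders contain a pending transaction in their
chain. -/
lemma Pending.exists_mem_ledger (hA : E.Admissible) (hL : E.Live) (hR : E.Rational)
    {x : Tx S.Validator} (hx : E.Pending x) :
    ∃ m₀, ∀ m, m₀ ≤ m → ∀ j ∈ S.correct, x ∈ (E.proposal (E.roundOf m j)).ledger := by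
  have hT : ∃ T : ℕ, ∀ p ∈ S.correct, E.mempool p x ≤ T := by
    refine ⟨∑ p ∈ S.correct, (E.mempool p x).toNat, fun p hp => ?_⟩
    rw [← ENat.natCast_toNat (hx.2.1 p hp)]
    exact_mod_cast Finset.single_le_sum (f := fun p => (E.mempool p x).toNat)
      (fun _ _ => Nat.zero_le _) hp
  obtain ⟨T, hT⟩ := hT
  refine ⟨max E.gst T, fun m hm j hj => ?_⟩
  have hlead := leader_roundOf (E := E) m j
  have hstart := (hm.trans (le_windowStart (S := S) m)).trans (windowStart_le (E := E) m j)
  have hj' : S.leader (E.roundOf m j) ∈ S.correct := hlead.symm ▸ hj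
  refine hL.includes _ hj' ((le_max_left _ _).trans hstart) (running hA hR _) x ?_
    (hx.2.2.2 _ hj')
  exact (hT _ hj').trans (by exact_mod_cast (le_max_right _ _).trans hstart)

lemma exists_finalized_of_mem_ledger (hA : E.Admissible) (hR : E.Rational)
    {b : Block S.Validator} (hb : E.Witnessed b) {x : Tx S.Validator} (hx : x ∈ b.ledger) :
    ∃ a, x ∈ a.txs ∧ E.FinalizedByAll a := by
  obtain ⟨a, ha, hxa⟩ := Block.mem_ledger.1 hx
  obtain ⟨p, hp, hw⟩ := hb
  exact ⟨a, hxa, finalizedByAll hA hR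
    ⟨p, hp, ne_top_of_le_ne_top hw (witness_le_of_mem_chain hA hp ha)⟩⟩

/-- Either some correct leader builds on a certified block that has the transaction in its chain,
or the proposals of correct leaders contain it themselves, hence carry fees. -/
lemma Pending.exists_finalized (hA : E.Admissible) (hL : E.Live) (hR : E.Rational)
    {x : Tx S.Validator} (hx : E.Pending x) : ∃ b, x ∈ b.txs ∧ E.FinalizedByAll b := by
  obtain ⟨m₁, hm₁⟩ := hx.exists_mem_ledger hA hL hR
  have hgst : ∀ m, max E.gst m₁ ≤ m → E.gst ≤ m * (3 * S.f + 1) * S.τ := fun m hm =>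
    ((le_max_left _ _).trans hm).trans (le_windowStart m)
  by_cases hpar : ∃ m, max E.gst m₁ ≤ m ∧ ∃ j ∈ S.correct,
      x ∈ (E.parent (E.roundOf m j)).ledger
  · obtain ⟨m, hm, j, hj, hxp⟩ := hpar
    have hlead := leader_roundOf (E := E) m j
    have hw := hL.extends_ledger (E.roundOf m j) (hlead.symm ▸ hj)
      ((hgst m hm).trans (windowStart_le m j)) (running hA hR _)
    rw [hlead] at hw
    exact exists_finalized_of_mem_ledger hA hR
      ⟨j, hj, ne_top_of_le_ne_top (ENat.natCast_ne_top _) hw⟩ hxp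
  push Not at hpar
  obtain ⟨m, hm, j, hj, hc⟩ := exists_certified hA hL hR (hgst _ le_rfl) fun m hm => by
    obtain ⟨j, hj⟩ := S.correct_nonempty
    refine ⟨j, ?_⟩
    have hmem := hm₁ m ((le_max_right _ _).trans hm) j hj
    simp only [proposal, Block.ledger, List.mem_append] at hmem
    have hcont := hmem.resolve_left (hpar m hm j hj)
    refine hx.1.trans_le (List.single_le_sum (fun _ _ => Nat.zero_le _) _ ?_)
    exact List.mem_map.2 ⟨x, hcont, rfl⟩
  refine exists_finalized_of_mem_ledger hA hR ?_ (hm₁ m ((le_max_right _ _).trans hm) j hj)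
  obtain ⟨t, ht⟩ := finalizedByAll_proposal hA hL hR (hgst m hm) hj hc j hj
  exact ht.witnessed hj

/-- If correct proposals carry fees, arbitrarily late proposals of correct leaders are
finalized. -/
lemma exists_finalized_proposal (hA : E.Admissible) (hL : E.Live) (hR : E.Rational)
    (hfee : ∀ r, S.leader r ∈ S.correct → 0 < (E.proposal r).fees) (m₁ : ℕ) :
    ∃ m, m₁ ≤ m ∧ ∃ j ∈ S.correct, E.FinalizedByAll (E.proposal (E.roundOf m j)) := by
  have hgst : ∀ m, max E.gst m₁ ≤ m → E.gst ≤ m * (3 * S.f + 1) * S.τ := fun m hm =>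
    ((le_max_left _ _).trans hm).trans (le_windowStart m)
  obtain ⟨m, hm, j, hj, hc⟩ := exists_certified hA hL hR (hgst _ le_rfl) fun m _ => by
    obtain ⟨j, hj⟩ := S.correct_nonempty
    exact ⟨j, hfee _ ((leader_roundOf (E := E) m j).symm ▸ hj)⟩
  exact ⟨m, (le_max_right _ _).trans hm, j, hj,
    finalizedByAll_proposal hA hL hR (hgst m hm) hj hc⟩

lemma liveness (hA : E.Admissible) (hL : E.Live) (hR : E.Rational) : E.Liveness := by
  refine ⟨fun x hx => hx.exists_finalized hA hL hR, fun hfee r => ⟨?_, fun x hx => ?_⟩⟩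
  · obtain ⟨m, hm, j, hj, hfin⟩ := exists_finalized_proposal hA hL hR hfee r
    exact ⟨_, hm.trans (le_roundOf m j), (leader_roundOf (E := E) m j).symm ▸ hj, hfin⟩
  · obtain ⟨m₁, hm₁⟩ := hx.exists_mem_ledger hA hL hR
    obtain ⟨m, hm, j, hj, hfin⟩ := exists_finalized_proposal hA hL hR hfee (max r m₁)
    exact ⟨_, ((le_max_left _ _).trans hm).trans (le_roundOf m j),
      (leader_roundOf (E := E) m j).symm ▸ hj, hm₁ m ((le_max_right _ _).trans hm) j hj, hfin⟩

end Execution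
end CoBRA

end

theorem mainTheorem2 (S : CoBRA.System) (E : CoBRA.Execution S)
    (hA : E.Admissible) (hL : E.Live) (hR : E.Rational) :
    E.Safety ∧ E.Liveness :=
  ⟨CoBRA.Execution.safety hA hR, CoBRA.Execution.liveness hA hL hR⟩
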